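/- Let $(R,\mathfrak m)$ be a Noetherian local ring of dimension $d$, and write $\ell$ for length of $R$-modules and $H^i_{\mathfrak m}$ for local cohomology with support in $\mathfrak m$. Assume that $R$ is generalized Cohen--Macaulay, that is, $H^i_{\mathfrak m}(R)$ has finite length for every $0\le i<d$, and let $$I(R)=\sum_{i=0}^{d-1}\binom{d-1}{i}\,\ell\big(H^i_{\mathfrak m}(R)\big)$$ be its Buchsbaum invariant. Call an element of $R$ a parameter element if it is a member of some system of parameters of $R$, i.e. of a sequence of $d$ elements generating an $\mathfrak m$-primary ideal. Let $f$ be a parameter element of $R$. Then for every $\varepsilon\in\mathfrak m^{I(R)}$ such that $f+\varepsilon$ is a parameter element of $R$, we have $$\ell\big(H^i_{\mathfrak m}(R/(f))\big)=\ell\big(H^i_{\mathfrak m}(R/(f+\varepsilon))\big)\qquad\text{for every integer } 0\le i<d-1.$$ -/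

import Mathlib

universe u

noncomputable section

/-- The `i`-th local cohomology module `H^i_𝔪(M)` of a module `M` over a local ring `(R, 𝔪)`. -/
abbrev localCohomologyAtMax (R : Type u) [CommRing R] [IsLocalRing R] (i : ℕ)
    (M : Type u) [AddCommGroup M] [Module R M] : ModuleCat.{u} R :=
  (localCohomology (IsLocalRing.maximalIdeal R) i).obj (ModuleCat.of R M)

/-- A local ring `(R, 𝔪)` is generalized Cohen-Macaulay if the local cohomology modules
`H^i_𝔪(R)`, `i < dim R`, all have finite length. -/
def IsGeneralizedCohenMacaulay (R : Type u) [CommRing R] [IsLocalRing R] : Prop :=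
  ∀ i : ℕ, (i : WithBot ℕ∞) < ringKrullDim R → IsFiniteLength R (localCohomologyAtMax R i R)

/-- The Buchsbaum invariant `I(R) = ∑_{i=0}^{d-1} (d-1 choose i) ℓ(H^i_𝔪(R))` of a local ring
of dimension `d`. It is finite when `R` is generalized Cohen-Macaulay,
see `buchsbaumInvariant_ne_top`. -/
def buchsbaumInvariant (R : Type u) [CommRing R] [IsLocalRing R] (d : ℕ) : ℕ∞ :=
  ∑ i ∈ Finset.range d, ((d - 1).choose i : ℕ∞) * Module.length R (localCohomologyAtMax R i R)

theorem buchsbaumInvariant_ne_top (R : Type u) [CommRing R] [IsLocalRing R] (d : ℕ)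
    (hd : ringKrullDim R = d) (hR : IsGeneralizedCohenMacaulay R) :
    buchsbaumInvariant R d ≠ ⊤ := by
  unfold buchsbaumInvariant
  refine (WithTop.sum_ne_top (s := Finset.range d)).2 fun i hi => ?_
  have hlen : Module.length R (localCohomologyAtMax R i R) ≠ ⊤ :=
    Module.length_ne_top_iff.2 (hR i (by
      rw [hd]; exact_mod_cast Finset.mem_range.1 hi))
  exact WithTop.mul_ne_top (ENat.natCast_ne_top _) hlen

/-- `x 0, …, x (n - 1)` is a system of parameters of the local ring `(R, 𝔪)`: `n = dim R` and the
ideal generated by the `x i` is `𝔪`-primary. -/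
def IsSystemOfParameters (R : Type u) [CommRing R] [IsLocalRing R] {n : ℕ} (x : Fin n → R) :
    Prop :=
  ringKrullDim R = n ∧
    (Ideal.span (Set.range x)).radical = IsLocalRing.maximalIdeal R

/-- `f` is a parameter element of the local ring `R`: it is the first member of a system of
parameters of `R`. -/
def IsParameterElement (R : Type u) [CommRing R] [IsLocalRing R] (f : R) : Prop :=
  ∃ (n : ℕ) (x : Fin (n + 1) → R), IsSystemOfParameters R x ∧ x 0 = f

end

/-! Multiplication by `f` factors as `R ↠ fR ↪ R`, and the inclusion has cokernel `R/(f)`. Suppose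
`Ann f` is `𝔪`-power torsion. Its local cohomology then vanishes in positive degrees, so `R → fR`
induces surjections on all local cohomology and isomorphisms in positive degrees. The long exact
sequence of `0 → fR → R → R/(f) → 0` turns into `ℓ(H^i(R/(f))) = ℓ(coker(f on H^i(R))) + ℓ(ker(f on
H^{i+1}(R)))`, which is `length_quotient_span_singleton`. Only the action of `f` on `H^k(R)` with `k
< d` enters. Since `ℓ(H^k(R)) ≤ I(R)`, the ideal `𝔪^{I(R)}` kills `H^k(R)`, so `f` and `f + ε` act
identically.

That `Ann f` is torsion holds because its dimension is at most `d - 1`, and finite length of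
`H^i(R)` for `i < d` forces submodules of that dimension to be torsion
(`isPowTorsion_of_supportDim_le`, by induction on dimension).

The local cohomology functor is a colimit of the derived functors `Ext R C n`, while long exact
sequences are at hand for `Abelian.Ext`. A natural comparison of the two through projective
resolutions makes the sequences available. -/

section

universe w v v' u'

open CategoryTheory Limits Opposite

/-! ### Naturality of the computation of Ext by projective resolutions. -/

namespace CategoryTheory.ProjectiveResolution

section Opposite

variable {V : Type u'} [Category.{v} V]

lemma unop_comp_iso_unop_inv {A B : Vᵒᵖ} {A' B' : V} (f : A ⟶ B) (e₁ : A ≅ op A') (e₂ : B ≅ op B')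
    (g : B' ⟶ A') (h : f ≫ e₂.hom = e₁.hom ≫ g.op) :
    f.unop ≫ e₁.unop.inv = e₂.unop.inv ≫ g := by
  have h' : e₁.inv ≫ f = g.op ≫ e₂.inv := by
    rw [Iso.inv_comp_eq, ← Category.assoc, ← h, Category.assoc, Iso.hom_inv_id, Category.comp_id]
  exact congrArg Quiver.Hom.unop h'

/-- Both naturality squares of `isoExt` have this shape: `Ext` comes from a left derived functor
valued in an opposite category, so each square is known before applying `unop`. -/
lemma unop_comp_iso_of_eq_conj {A B A₁ B₁ : Vᵒᵖ} {A' B' : V} (f : A ⟶ B) (i₁ : A ≅ A₁) (i₂ : B ≅ B₁)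
    (m : A₁ ⟶ B₁) (hf : f = i₁.hom ≫ m ≫ i₂.inv) (j₁ : A' ≅ unop A₁) (j₂ : B' ≅ unop B₁)
    (m' : B' ⟶ A') (hm : m.unop ≫ j₁.inv = j₂.inv ≫ m') :
    f.unop ≫ (i₁.unop.symm ≪≫ j₁.symm).hom = (i₂.unop.symm ≪≫ j₂.symm).hom ≫ m' := by
  subst hf
  have h₁ : i₁.hom.unop ≫ i₁.inv.unop = 𝟙 _ := by rw [← unop_comp, Iso.inv_hom_id]; rfl
  simp only [unop_comp, Category.assoc, Iso.trans_hom, Iso.symm_hom, Iso.unop_inv,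
    reassoc_of% h₁, hm]

lemma homologyUnop_inv_naturality [Abelian V] {ι : Type*} {c : ComplexShape ι}
    {K L : HomologicalComplex Vᵒᵖ c} (φ : K ⟶ L) (i : ι) :
    (HomologicalComplex.homologyMap φ i).unop ≫ (K.homologyUnop i).inv =
      (L.homologyUnop i).inv ≫
        HomologicalComplex.homologyMap ((HomologicalComplex.unopFunctor V c).map φ.op) i :=
  unop_comp_iso_unop_inv _ (K.unop.homologyOp i) (L.unop.homologyOp i) _
    (HomologicalComplex.homologyOp_hom_naturality
      ((HomologicalComplex.unopFunctor V c).map φ.op) i)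

end Opposite

variable {C : Type u'} [Category.{v} C] [Abelian C]

/-- Postcomposition with `g : Y ⟶ Y'`, as a map of complexes `Hom(P, Y) ⟶ Hom(P, Y')`. -/
noncomputable def linearYonedaObjMapRight (R : Type w) [Ring R] [Linear R C] (P : ChainComplex C ℕ)
    {Y Y' : C} (g : Y ⟶ Y') : P.linearYonedaObj R Y ⟶ P.linearYonedaObj R Y' where
  f i := ModuleCat.ofHom (Linear.rightComp R (P.X i) g)
  comm' i j _ := by
    ext x
    exact (Category.assoc (P.d j i) (x : P.X i ⟶ Y) g).symm

/-- Precomposition with `φ : P' ⟶ P`, as a map of complexes `Hom(P, Y) ⟶ Hom(P', Y)`. -/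
noncomputable def linearYonedaObjMapLeft (R : Type w) [Ring R] [Linear R C]
    {P P' : ChainComplex C ℕ} (φ : P' ⟶ P) (Y : C) :
    P.linearYonedaObj R Y ⟶ P'.linearYonedaObj R Y where
  f i := ModuleCat.ofHom (Linear.leftComp R Y (φ.f i))
  comm' i j _ := by
    ext x
    have h (x : P.X i ⟶ Y) : P'.d j i ≫ φ.f i ≫ x = φ.f j ≫ P.d j i ≫ x := by simp
    exact h x

variable (R : Type w) [Ring R] [Linear R C] [EnoughProjectives C]

lemma isoExt_hom_naturality_right {X : C} (P : ProjectiveResolution X) (n : ℕ) {Y Y' : C}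
    (g : Y ⟶ Y') :
    ((_root_.Ext R C n).obj (op X)).map g ≫ (P.isoExt n Y').hom =
      (P.isoExt n Y).hom ≫
        HomologicalComplex.homologyMap (linearYonedaObjMapRight R P.complex g) n :=
  unop_comp_iso_of_eq_conj _ _ _ _ (leftDerived_app_eq (((linearYoneda R C).map g).rightOp) P n)
    _ _ _ (homologyUnop_inv_naturality _ n)

lemma isoExt_hom_naturality_left {X X' : C} (P : ProjectiveResolution X)
    (P' : ProjectiveResolution X') (n : ℕ) (a : X' ⟶ X) (φ : P'.Hom P a) (Y : C) :
    ((_root_.Ext R C n).map a.op).app Y ≫ (P'.isoExt n Y).hom =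
      (P.isoExt n Y).hom ≫
        HomologicalComplex.homologyMap (linearYonedaObjMapLeft R φ.hom Y) n :=
  unop_comp_iso_of_eq_conj _ _ _ _
    (((linearYoneda R C).obj Y).rightOp.leftDerived_map_eq n a φ.hom (by simp))
    _ _ _ (homologyUnop_inv_naturality _ n)

end CategoryTheory.ProjectiveResolution

/-! ### Cocycles of `Hom(P, Y)` and classes in `Abelian.Ext`. -/

namespace CategoryTheory.ProjectiveResolution
open CochainComplex HomComplex Abelian
variable {C : Type u'} [Category.{v} C] [Abelian C] [HasExt.{w} C]

/-- A coboundary in degree 0 would factor through degree 1 of a cochain complex that vanishes in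
positive degrees. -/
lemma extMk_zero_eq_zero_iff {X Y : C} (P : ProjectiveResolution X) (f : P.complex.X 0 ⟶ Y)
    (hf : P.complex.d 1 0 ≫ f = 0) :
    P.extMk f 1 (zero_add 1) hf = 0 ↔ f = 0 := by
  refine ⟨fun h ↦ ?_, fun h ↦ by subst h; simp⟩
  rw [← P.extEquivCohomologyClass.apply_eq_iff_eq, extEquivCohomologyClass_extMk,
    extEquivCohomologyClass_zero, CohomologyClass.mk_eq_zero_iff,
    Cocycle.toSingleMk_mem_coboundaries_iff _ _ _ _ _ 1 (by simp)] at h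
  obtain ⟨g, hg⟩ := h
  have hz : IsZero (P.cochainComplex.X 1) := P.cochainComplex.isZero_of_isStrictlyLE 0 1
  rw [hz.eq_of_src g 0, comp_zero] at hg
  rw [← cancel_epi (P.cochainComplexXIso (-(0 : ℕ)) 0 rfl).hom, ← hg, comp_zero]

lemma extMk_smul {R : Type*} [Ring R] [Linear R C] {X Y : C} (P : ProjectiveResolution X) {n : ℕ}
    (f : P.complex.X n ⟶ Y) (m : ℕ) (hm : n + 1 = m) (hf : P.complex.d m n ≫ f = 0) (r : R) :
    r • P.extMk f m hm hf = P.extMk (r • f) m hm (by simp [hf]) := by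
  rw [Ext.smul_eq_comp_mk₀, extMk_comp_mk₀]
  simp

lemma extMk_eq_zero_iff_mem_range {R : Type v'} [Ring R] [Linear R C] {X Y : C}
    (P : ProjectiveResolution X)
    {n : ℕ} (f : P.complex.X n ⟶ Y) (hf : P.complex.d (n + 1) n ≫ f = 0) :
    P.extMk f (n + 1) rfl hf = 0 ↔
      ∃ g : (P.complex.linearYonedaObj R Y).X ((ComplexShape.up ℕ).prev n),
        (P.complex.linearYonedaObj R Y).d _ n g = f := by
  -- In degree 0, `prev` returns 0 itself and the differential there is zero, so the range is
  -- trivial.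
  obtain _ | n := n
  · rw [extMk_zero_eq_zero_iff, HomologicalComplex.shape _ _ 0 (by simp)]
    exact ⟨fun h ↦ ⟨0, h.symm⟩, fun ⟨g, hg⟩ ↦ hg.symm⟩
  · rw [P.extMk_eq_zero_iff f _ rfl hf n rfl, CochainComplex.prev_nat_succ]
    rfl

variable (R : Type v') [Ring R] [Linear R C]

omit [HasExt.{w} C] in
/-- The underlying morphism of a cocycle of the complex `Hom(P, Y)`. -/
noncomputable def cyclesHom {X : C} (P : ProjectiveResolution X) (Y : C) (n : ℕ) :
    (P.complex.linearYonedaObj R Y).cycles n →ₗ[R] (P.complex.X n ⟶ Y) :=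
  ((P.complex.linearYonedaObj R Y).iCycles n).hom

omit [HasExt.{w} C] in
lemma d_comp_cyclesHom {X : C} (P : ProjectiveResolution X) (Y : C) (n : ℕ)
    (z : (P.complex.linearYonedaObj R Y).cycles n) :
    P.complex.d (n + 1) n ≫ P.cyclesHom R Y n z = 0 :=
  congrArg (fun f ↦ f.hom z) ((P.complex.linearYonedaObj R Y).iCycles_d n (n + 1))

omit [HasExt.{w} C] in
lemma exists_cyclesHom_eq {X : C} (P : ProjectiveResolution X) (Y : C) (n : ℕ)
    (f : P.complex.X n ⟶ Y) (hf : P.complex.d (n + 1) n ≫ f = 0) :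
    ∃ z, P.cyclesHom R Y n z = f := by
  have hf' : ((P.complex.linearYonedaObj R Y).sc n).g.hom f = 0 := by
    change (P.complex.linearYonedaObj R Y).d n _ f = 0
    rw [CochainComplex.next]
    exact hf
  exact ⟨((P.complex.linearYonedaObj R Y).sc n).moduleCatCyclesIso.inv ⟨f, hf'⟩,
    congrArg (fun φ ↦ φ.hom ⟨f, hf'⟩)
      ((P.complex.linearYonedaObj R Y).sc n).moduleCatCyclesIso_inv_iCycles⟩

lemma homologyπ_eq_zero_iff (K : CochainComplex (ModuleCat.{v} R) ℕ) (n : ℕ) (z : K.cycles n) :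
    K.homologyπ n z = 0 ↔ ∃ y : K.X ((ComplexShape.up ℕ).prev n), K.d _ n y = K.iCycles n z := by
  have h := ShortComplex.exact_of_g_is_cokernel
    (ShortComplex.mk (K.toCycles ((ComplexShape.up ℕ).prev n) n) (K.homologyπ n) (by simp))
    (K.homologyIsCokernel _ n rfl)
  rw [ShortComplex.moduleCat_exact_iff] at h
  have h' (y : K.X ((ComplexShape.up ℕ).prev n)) :
      K.iCycles n (K.toCycles _ n y) = K.d _ n y :=
    congrArg (fun f ↦ f.hom y) (K.toCycles_i ((ComplexShape.up ℕ).prev n) n)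
  refine ⟨fun hz ↦ ?_, fun ⟨y, hy⟩ ↦ ?_⟩
  · obtain ⟨y, rfl⟩ := h z hz
    exact ⟨y, (h' y).symm⟩
  · have : z = K.toCycles _ n y :=
      (ModuleCat.mono_iff_injective (K.iCycles n)).1 inferInstance (hy.symm.trans (h' y).symm)
    subst this
    exact congrArg (fun f ↦ f.hom y) (K.toCycles_comp_homologyπ ((ComplexShape.up ℕ).prev n) n)

/-- The class in `Ext X Y n` of a cocycle of the complex `Hom(P, Y)`. -/
noncomputable def cyclesToExt {X : C} (P : ProjectiveResolution X) (Y : C) (n : ℕ) :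
    (P.complex.linearYonedaObj R Y).cycles n →ₗ[R] Abelian.Ext X Y n where
  toFun z := P.extMk (P.cyclesHom R Y n z) (n + 1) rfl (P.d_comp_cyclesHom R Y n z)
  map_add' z z' := by
    rw [add_extMk]
    congr 1
    exact map_add _ z z'
  map_smul' r z := by
    rw [RingHom.id_apply, extMk_smul]
    congr 1
    exact map_smul _ r z

lemma cyclesToExt_apply {X : C} (P : ProjectiveResolution X) (Y : C) (n : ℕ)
    (z : (P.complex.linearYonedaObj R Y).cycles n) :
    P.cyclesToExt R Y n z =
      P.extMk (P.cyclesHom R Y n z) (n + 1) rfl (P.d_comp_cyclesHom R Y n z) := rfl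

lemma cyclesToExt_surjective {X : C} (P : ProjectiveResolution X) (Y : C) (n : ℕ) :
    Function.Surjective (P.cyclesToExt R Y n) := by
  intro x
  obtain ⟨f, hf, rfl⟩ := P.extMk_surjective x (n + 1) rfl
  obtain ⟨z, rfl⟩ := P.exists_cyclesHom_eq R Y n f hf
  exact ⟨z, rfl⟩

lemma cyclesToExt_eq_zero_iff {X : C} (P : ProjectiveResolution X) (Y : C) (n : ℕ)
    (z : (P.complex.linearYonedaObj R Y).cycles n) :
    P.cyclesToExt R Y n z = 0 ↔ (P.complex.linearYonedaObj R Y).homologyπ n z = 0 := by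
  rw [cyclesToExt_apply, extMk_eq_zero_iff_mem_range (R := R)]
  exact (homologyπ_eq_zero_iff R _ n z).symm

/-- The class in `Ext X Y n` of a cohomology class of the complex `Hom(P, Y)`. -/
noncomputable def homologyEquivExt {X : C} (P : ProjectiveResolution X) (Y : C) (n : ℕ) :
    (P.complex.linearYonedaObj R Y).homology n ≃ₗ[R] Abelian.Ext X Y n :=
  ((((P.complex.linearYonedaObj R Y).homologyπ n).hom.quotKerEquivOfSurjective
    ((ModuleCat.epi_iff_surjective _).1 inferInstance)).symm.trans
      (Submodule.quotEquivOfEq _ _ (by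
        ext z
        exact (P.cyclesToExt_eq_zero_iff R Y n z).symm))).trans
    ((P.cyclesToExt R Y n).quotKerEquivOfSurjective (P.cyclesToExt_surjective R Y n))

lemma homologyEquivExt_homologyπ {X : C} (P : ProjectiveResolution X) (Y : C) (n : ℕ)
    (z : (P.complex.linearYonedaObj R Y).cycles n) :
    P.homologyEquivExt R Y n ((P.complex.linearYonedaObj R Y).homologyπ n z) =
      P.cyclesToExt R Y n z := by
  have h : (((P.complex.linearYonedaObj R Y).homologyπ n).hom.quotKerEquivOfSurjective
    ((ModuleCat.epi_iff_surjective _).1 inferInstance)).symm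
      ((P.complex.linearYonedaObj R Y).homologyπ n z) = Submodule.Quotient.mk z := by
    rw [LinearEquiv.symm_apply_eq]
    rfl
  simp only [homologyEquivExt, LinearEquiv.trans_apply]
  rw [h]
  rfl

lemma homologyEquivExt_naturality_right {X : C} (P : ProjectiveResolution X) (n : ℕ) {Y Y' : C}
    (g : Y ⟶ Y') (x : (P.complex.linearYonedaObj R Y).homology n) :
    P.homologyEquivExt R Y' n
        (HomologicalComplex.homologyMap (linearYonedaObjMapRight R P.complex g) n x) =
      (P.homologyEquivExt R Y n x).comp (Ext.mk₀ g) (add_zero n) := by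
  obtain ⟨z, rfl⟩ := (ModuleCat.epi_iff_surjective
    ((P.complex.linearYonedaObj R Y).homologyπ n)).1 inferInstance x
  have h := congrArg (fun φ ↦ φ.hom z)
    (HomologicalComplex.homologyπ_naturality (linearYonedaObjMapRight R P.complex g) n)
  have h' := congrArg (fun φ ↦ φ.hom z)
    (HomologicalComplex.cyclesMap_i (linearYonedaObjMapRight R P.complex g) n)
  rw [homologyEquivExt_homologyπ, cyclesToExt_apply, extMk_comp_mk₀]
  refine (congrArg (P.homologyEquivExt R Y' n) h).trans ?_
  refine (P.homologyEquivExt_homologyπ R Y' n _).trans ?_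
  rw [cyclesToExt_apply]
  congr 1

lemma homologyEquivExt_naturality_left {X X' : C} (P : ProjectiveResolution X)
    (P' : ProjectiveResolution X') (n : ℕ) (a : X' ⟶ X) (φ : P'.Hom P a) (Y : C)
    (x : (P.complex.linearYonedaObj R Y).homology n) :
    P'.homologyEquivExt R Y n
        (HomologicalComplex.homologyMap (linearYonedaObjMapLeft R φ.hom Y) n x) =
      (Ext.mk₀ a).comp (P.homologyEquivExt R Y n x) (zero_add n) := by
  obtain ⟨z, rfl⟩ := (ModuleCat.epi_iff_surjective
    ((P.complex.linearYonedaObj R Y).homologyπ n)).1 inferInstance x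
  have h := congrArg (fun φ ↦ φ.hom z)
    (HomologicalComplex.homologyπ_naturality (linearYonedaObjMapLeft R φ.hom Y) n)
  have h' := congrArg (fun φ ↦ φ.hom z)
    (HomologicalComplex.cyclesMap_i (linearYonedaObjMapLeft R φ.hom Y) n)
  rw [homologyEquivExt_homologyπ, cyclesToExt_apply, mk₀_comp_extMk _ _ _ _ φ]
  refine (congrArg (P'.homologyEquivExt R Y n) h).trans ?_
  refine (P'.homologyEquivExt_homologyπ R Y n _).trans ?_
  rw [cyclesToExt_apply]
  congr 1

end CategoryTheory.ProjectiveResolution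

/-! ### Natural comparison of the two versions of Ext. -/

namespace CategoryTheory.Abelian
variable {C : Type u'} [Category.{v} C] [Abelian C] [HasExt.{w} C] [EnoughProjectives C]
variable (R : Type v') [Ring R] [Linear R C]

/-- The comparison between the `Ext` functor defined by deriving in the first variable and the
`Ext` modules defined in the derived category. -/
noncomputable def extObjEquivExt (X Y : C) (n : ℕ) :
    ((_root_.Ext R C n).obj (op X)).obj Y ≃ₗ[R] Ext X Y n :=
  (((projectiveResolution X).isoExt n Y).toLinearEquiv).trans
    ((projectiveResolution X).homologyEquivExt R Y n)

lemma extObjEquivExt_apply (X Y : C) (n : ℕ) (x : ((_root_.Ext R C n).obj (op X)).obj Y) :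
    extObjEquivExt R X Y n x = (projectiveResolution X).homologyEquivExt R Y n
      (((projectiveResolution X).isoExt n Y).hom x) := rfl

lemma extObjEquivExt_map (X : C) {Y Y' : C} (g : Y ⟶ Y') (n : ℕ)
    (x : ((_root_.Ext R C n).obj (op X)).obj Y) :
    extObjEquivExt R X Y' n (((_root_.Ext R C n).obj (op X)).map g x) =
      (extObjEquivExt R X Y n x).comp (Ext.mk₀ g) (add_zero n) := by
  have h : ((projectiveResolution X).isoExt n Y').hom
      (((_root_.Ext R C n).obj (op X)).map g x) =
      HomologicalComplex.homologyMap (ProjectiveResolution.linearYonedaObjMapRight R _ g) n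
        (((projectiveResolution X).isoExt n Y).hom x) :=
    congrArg (fun φ ↦ φ.hom x)
      (ProjectiveResolution.isoExt_hom_naturality_right R (projectiveResolution X) n g)
  rw [extObjEquivExt_apply, extObjEquivExt_apply, h,
    ProjectiveResolution.homologyEquivExt_naturality_right]

lemma extObjEquivExt_map_app {X X' : C} (a : X' ⟶ X) (Y : C) (n : ℕ)
    (x : ((_root_.Ext R C n).obj (op X)).obj Y) :
    extObjEquivExt R X' Y n (((_root_.Ext R C n).map a.op).app Y x) =
      (Ext.mk₀ a).comp (extObjEquivExt R X Y n x) (zero_add n) := by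
  let φ : (projectiveResolution X').Hom (projectiveResolution X) a :=
    ⟨ProjectiveResolution.lift a _ _,
      (ProjectiveResolution.lift_commutes_zero _ _ _).trans
        (by rw [ChainComplex.single₀_map_f_zero]; rfl)⟩
  have h : ((projectiveResolution X').isoExt n Y).hom (((_root_.Ext R C n).map a.op).app Y x) =
      HomologicalComplex.homologyMap (ProjectiveResolution.linearYonedaObjMapLeft R φ.hom Y) n
        (((projectiveResolution X).isoExt n Y).hom x) :=
    congrArg (fun ψ ↦ ψ.hom x)
      (ProjectiveResolution.isoExt_hom_naturality_left R (projectiveResolution X)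
        (projectiveResolution X') n a φ Y)
  rw [extObjEquivExt_apply, extObjEquivExt_apply, h,
    (projectiveResolution X).homologyEquivExt_naturality_left R (projectiveResolution X') n a φ Y]

end CategoryTheory.Abelian

/-! ### Local cohomology as a colimit of `Abelian.Ext`. -/

namespace localCohomology
variable {R : Type u} [CommRing R] (J : Ideal R) (i : ℕ)

instance preservesFilteredColimitsOfSize_forget :
    PreservesFilteredColimitsOfSize.{0, 0} (forget (ModuleCat.{u} R)) :=
  preservesFilteredColimitsOfSize_shrink.{0, u, 0, u} _

/-- The quotient `R ⧸ J ^ n` as an object of the category of modules. -/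
abbrev powQuot (n : ℕ) : ModuleCat.{u} R := ModuleCat.of R (R ⧸ J ^ n)

/-- The projection `R ⧸ J ^ m ⟶ R ⧸ J ^ n`. -/
noncomputable def powQuotMap {n m : ℕ} (h : n ≤ m) : powQuot J m ⟶ powQuot J n :=
  ModuleCat.ofHom (Submodule.mapQ _ _ LinearMap.id (Ideal.pow_le_pow_right h))

/-- The modules `Ext^i(R ⧸ J ^ n, M)`, whose colimit is the local cohomology of `M`. -/
noncomputable abbrev extDiagram (M : ModuleCat.{u} R) : ℕᵒᵖᵒᵖ ⥤ ModuleCat.{u} R :=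
  diagram (idealPowersDiagram J) i ⋙ (evaluation (ModuleCat.{u} R) (ModuleCat.{u} R)).obj M

/-- The cocone exhibiting local cohomology as a colimit. -/
noncomputable def extCocone (M : ModuleCat.{u} R) : Cocone (extDiagram J i M) :=
  ((evaluation (ModuleCat.{u} R) (ModuleCat.{u} R)).obj M).mapCocone
    (colimit.cocone (diagram (idealPowersDiagram J) i))

/-- Local cohomology is the colimit of `Ext^i(R ⧸ J ^ n, M)`. -/
noncomputable def isColimitExtCocone (M : ModuleCat.{u} R) : IsColimit (extCocone J i M) :=
  isColimitOfPreserves _ (colimit.isColimit (diagram (idealPowersDiagram J) i))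

/-- The structure maps of local cohomology as a colimit. -/
noncomputable def ofExtObj (n : ℕ) (M : ModuleCat.{u} R) :
    ((_root_.Ext R (ModuleCat.{u} R) i).obj (op (powQuot J n))).obj M →ₗ[R]
      (localCohomology J i).obj M :=
  ((extCocone J i M).ι.app (op (op n))).hom

lemma exists_ofExtObj_eq (M : ModuleCat.{u} R) (x : (localCohomology J i).obj M) :
    ∃ n y, ofExtObj J i n M y = x := by
  obtain ⟨j, y, hy⟩ := Concrete.isColimit_exists_rep _ (isColimitExtCocone J i M) x
  exact ⟨j.unop.unop, y, hy⟩

lemma exists_map_eq_zero_of_ofExtObj_eq_zero (n : ℕ) (M : ModuleCat.{u} R)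
    (y : ((_root_.Ext R (ModuleCat.{u} R) i).obj (op (powQuot J n))).obj M)
    (hy : ofExtObj J i n M y = 0) :
    ∃ (m : ℕ) (h : n ≤ m),
      (((_root_.Ext R (ModuleCat.{u} R) i).map (powQuotMap J h).op).app M) y = 0 := by
  have h0 : ofExtObj J i n M y = ofExtObj J i n M 0 := by rw [hy, map_zero]
  obtain ⟨j, f, g, h⟩ := Concrete.isColimit_exists_of_rep_eq (extDiagram J i M)
    (isColimitExtCocone J i M) (i := op (op n)) (j := op (op n)) y 0 h0
  refine ⟨j.unop.unop, leOfHom f.unop.unop, ?_⟩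
  exact h.trans (map_zero ((extDiagram J i M).map g).hom)

/-- The canonical map from `Ext^i(R ⧸ J ^ n, M)` to the local cohomology of `M`. -/
noncomputable def ofExt (n : ℕ) (M : ModuleCat.{u} R) :
    Abelian.Ext (powQuot J n) M i →ₗ[R] (localCohomology J i).obj M :=
  ofExtObj J i n M ∘ₗ (Abelian.extObjEquivExt R (powQuot J n) M i).symm.toLinearMap

variable {i}

lemma ofExt_extObjEquivExt (n : ℕ) (M : ModuleCat.{u} R)
    (y : ((_root_.Ext R (ModuleCat.{u} R) i).obj (op (powQuot J n))).obj M) :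
    ofExt J i n M (Abelian.extObjEquivExt R (powQuot J n) M i y) = ofExtObj J i n M y :=
  congrArg (ofExtObj J i n M) (LinearEquiv.symm_apply_apply _ y)

lemma map_ofExt (n : ℕ) {M N : ModuleCat.{u} R} (g : M ⟶ N) (x : Abelian.Ext (powQuot J n) M i) :
    (localCohomology J i).map g (ofExt J i n M x) =
      ofExt J i n N (x.comp (Abelian.Ext.mk₀ g) (add_zero i)) := by
  obtain ⟨y, rfl⟩ := (Abelian.extObjEquivExt R (powQuot J n) M i).surjective x
  rw [← Abelian.extObjEquivExt_map, ofExt_extObjEquivExt, ofExt_extObjEquivExt]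
  exact (congrArg (fun φ ↦ φ.hom y)
    ((colimit.ι (diagram (idealPowersDiagram J) i) (op (op n))).naturality g)).symm

lemma ofExt_precomp {n m : ℕ} (hnm : n ≤ m) (M : ModuleCat.{u} R)
    (x : Abelian.Ext (powQuot J n) M i) :
    ofExt J i m M ((Abelian.Ext.mk₀ (powQuotMap J hnm)).comp x (zero_add i)) =
      ofExt J i n M x := by
  obtain ⟨y, rfl⟩ := (Abelian.extObjEquivExt R (powQuot J n) M i).surjective x
  rw [← Abelian.extObjEquivExt_map_app, ofExt_extObjEquivExt, ofExt_extObjEquivExt]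
  exact congrArg (fun φ ↦ φ.hom y) ((extCocone J i M).w (homOfLE hnm).op.op)

lemma exists_ofExt_eq (M : ModuleCat.{u} R) (x : (localCohomology J i).obj M) :
    ∃ n y, ofExt J i n M y = x := by
  obtain ⟨n, y, rfl⟩ := exists_ofExtObj_eq J i M x
  exact ⟨n, _, ofExt_extObjEquivExt J n M y⟩

lemma ofExt_eq_zero_iff (n : ℕ) (M : ModuleCat.{u} R) (x : Abelian.Ext (powQuot J n) M i) :
    ofExt J i n M x = 0 ↔ ∃ (m : ℕ) (h : n ≤ m),
      (Abelian.Ext.mk₀ (powQuotMap J h)).comp x (zero_add i) = 0 := by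
  refine ⟨fun hx ↦ ?_, fun ⟨m, h, hm⟩ ↦ by rw [← ofExt_precomp J h, hm, map_zero]⟩
  obtain ⟨y, rfl⟩ := (Abelian.extObjEquivExt R (powQuot J n) M i).surjective x
  rw [ofExt_extObjEquivExt] at hx
  obtain ⟨m, h, hm⟩ := exists_map_eq_zero_of_ofExtObj_eq_zero J i n M y hx
  exact ⟨m, h, by rw [← Abelian.extObjEquivExt_map_app, hm, map_zero]⟩

end localCohomology

/-! ### Maps on local cohomology. -/

namespace localCohomology
variable {R : Type u} [CommRing R] (J : Ideal R) (i : ℕ)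

/-- The cocone defined by a compatible family of linear maps out of the modules
`Ext^i(R ⧸ J ^ n, M)`. -/
noncomputable def coconeOfExt {i : ℕ} {M : ModuleCat.{u} R} {P : Type u} [AddCommGroup P]
    [Module R P] (g : ∀ n, Abelian.Ext (powQuot J n) M i →ₗ[R] P)
    (hg : ∀ (n m : ℕ) (h : n ≤ m) (x : Abelian.Ext (powQuot J n) M i),
      g m ((Abelian.Ext.mk₀ (powQuotMap J h)).comp x (zero_add i)) = g n x) :
    Cocone (extDiagram J i M) where
  pt := ModuleCat.of R P
  ι :=
    { app j := ModuleCat.ofHom (g j.unop.unop ∘ₗ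
        (Abelian.extObjEquivExt R (powQuot J j.unop.unop) M i).toLinearMap)
      naturality j k f := by
        have h (n m : ℕ) (h : n ≤ m)
            (y : ((_root_.Ext R (ModuleCat.{u} R) i).obj (op (powQuot J n))).obj M) :
            g m (Abelian.extObjEquivExt R (powQuot J m) M i
              (((_root_.Ext R (ModuleCat.{u} R) i).map (powQuotMap J h).op).app M y)) =
            g n (Abelian.extObjEquivExt R (powQuot J n) M i y) := by
          rw [Abelian.extObjEquivExt_map_app, hg]
        ext y
        exact h j.unop.unop k.unop.unop (leOfHom f.unop.unop) y }

/-- A compatible family of linear maps out of the modules `Ext^i(R ⧸ J ^ n, M)` defines a linear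
map out of local cohomology. -/
noncomputable def descExt {i : ℕ} {M : ModuleCat.{u} R} {P : Type u} [AddCommGroup P] [Module R P]
    (g : ∀ n, Abelian.Ext (powQuot J n) M i →ₗ[R] P)
    (hg : ∀ (n m : ℕ) (h : n ≤ m) (x : Abelian.Ext (powQuot J n) M i),
      g m ((Abelian.Ext.mk₀ (powQuotMap J h)).comp x (zero_add i)) = g n x) :
    (localCohomology J i).obj M →ₗ[R] P :=
  ((isColimitExtCocone J i M).desc (coconeOfExt J g hg)).hom

lemma descExt_ofExt {i : ℕ} {M : ModuleCat.{u} R} {P : Type u} [AddCommGroup P] [Module R P]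
    (g : ∀ n, Abelian.Ext (powQuot J n) M i →ₗ[R] P)
    (hg : ∀ (n m : ℕ) (h : n ≤ m) (x : Abelian.Ext (powQuot J n) M i),
      g m ((Abelian.Ext.mk₀ (powQuotMap J h)).comp x (zero_add i)) = g n x)
    (n : ℕ) (x : Abelian.Ext (powQuot J n) M i) :
    descExt J g hg (ofExt J i n M x) = g n x := by
  obtain ⟨y, rfl⟩ := (Abelian.extObjEquivExt R (powQuot J n) M i).surjective x
  rw [ofExt_extObjEquivExt]
  have h := (isColimitExtCocone J i M).fac (coconeOfExt J g hg) (op (op n))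
  exact congrArg (fun φ ↦ φ.hom y) h

/-- The linear map on local cohomology induced by a linear map. -/
noncomputable def mapₗ {M N : Type u} [AddCommGroup M] [Module R M] [AddCommGroup N] [Module R N]
    (φ : M →ₗ[R] N) :
    (localCohomology J i).obj (ModuleCat.of R M) →ₗ[R]
      (localCohomology J i).obj (ModuleCat.of R N) :=
  ((localCohomology J i).map (ModuleCat.ofHom φ)).hom

section

variable {M N P : Type u} [AddCommGroup M] [Module R M] [AddCommGroup N] [Module R N]
  [AddCommGroup P] [Module R P]

lemma mapₗ_comp (ψ : N →ₗ[R] P) (φ : M →ₗ[R] N) :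
    mapₗ J i (ψ ∘ₗ φ) = mapₗ J i ψ ∘ₗ mapₗ J i φ := by
  rw [mapₗ, ModuleCat.ofHom_comp, Functor.map_comp]
  rfl

lemma mapₗ_ofExt (n : ℕ) (φ : M →ₗ[R] N)
    (x : Abelian.Ext (powQuot J n) (ModuleCat.of R M) i) :
    mapₗ J i φ (ofExt J i n _ x) =
      ofExt J i n _ (x.comp (Abelian.Ext.mk₀ (ModuleCat.ofHom φ)) (add_zero i)) :=
  map_ofExt J n _ x

lemma mapₗ_smul_id (r : R) : mapₗ J i (r • (LinearMap.id : M →ₗ[R] M)) = r • LinearMap.id := by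
  ext x
  obtain ⟨n, y, rfl⟩ := exists_ofExt_eq J _ x
  rw [mapₗ_ofExt, LinearMap.smul_apply, LinearMap.id_apply, ← map_smul,
    Abelian.Ext.smul_eq_comp_mk₀]
  rfl

lemma mapₗ_zero : mapₗ J i (0 : M →ₗ[R] N) = 0 := by
  ext x
  obtain ⟨n, y, rfl⟩ := exists_ofExt_eq J _ x
  rw [mapₗ_ofExt, ModuleCat.ofHom_zero, Abelian.Ext.mk₀_zero, Abelian.Ext.comp_zero, map_zero]
  rfl

lemma subsingleton_of_injective_module [Injective (ModuleCat.of R M)] :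
    Subsingleton ((localCohomology J (i + 1)).obj (ModuleCat.of R M)) := by
  refine subsingleton_of_forall_eq 0 fun x ↦ ?_
  obtain ⟨n, y, rfl⟩ := exists_ofExt_eq J _ x
  rw [y.eq_zero_of_injective, map_zero]

end

/-! ### The long exact sequence. -/

section LongExactSequence

variable {A B C : Type u} [AddCommGroup A] [Module R A] [AddCommGroup B] [Module R B]
  [AddCommGroup C] [Module R C]

/-- A vanishing in the colimit already holds over some `R ⧸ J ^ m`, where the covariant Ext sequence
supplies the preimage. -/
lemma exact_mapₗ {f : A →ₗ[R] B} {g : B →ₗ[R] C} (hf : Function.Injective f)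
    (hfg : Function.Exact f g) (hg : Function.Surjective g) :
    Function.Exact (mapₗ J i f) (mapₗ J i g) := by
  have hS : (ModuleCat.shortComplexOfCompEqZero f g hfg.linearMap_comp_eq_zero).ShortExact :=
    ModuleCat.shortComplex_shortExact _ hfg hf hg
  intro x
  constructor
  · intro hx
    obtain ⟨n, y, rfl⟩ := exists_ofExt_eq J _ x
    rw [mapₗ_ofExt, ofExt_eq_zero_iff] at hx
    obtain ⟨m, h, hm⟩ := hx
    rw [← Abelian.Ext.comp_assoc_of_third_deg_zero] at hm
    obtain ⟨z, hz⟩ := Abelian.Ext.covariant_sequence_exact₂ _ hS _ hm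
    exact ⟨ofExt J i m _ z, by rw [mapₗ_ofExt]; exact (congrArg _ hz).trans (ofExt_precomp J h _ y)⟩
  · rintro ⟨y, rfl⟩
    rw [← LinearMap.comp_apply, ← mapₗ_comp, hfg.linearMap_comp_eq_zero, mapₗ_zero]
    rfl

/-- At each level the connecting map is the Yoneda product with the extension class; associativity
of products makes the levels compatible. -/
theorem exists_connecting {f : A →ₗ[R] B} {g : B →ₗ[R] C} (hf : Function.Injective f)
    (hfg : Function.Exact f g) (hg : Function.Surjective g) :
    ∃ δ : (localCohomology J i).obj (ModuleCat.of R C) →ₗ[R]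
        (localCohomology J (i + 1)).obj (ModuleCat.of R A),
      Function.Exact (mapₗ J i g) δ ∧ Function.Exact δ (mapₗ J (i + 1) f) := by
  have hS : (ModuleCat.shortComplexOfCompEqZero f g hfg.linearMap_comp_eq_zero).ShortExact :=
    ModuleCat.shortComplex_shortExact _ hfg hf hg
  have hcompat (n m : ℕ) (h : n ≤ m) (x : Abelian.Ext (powQuot J n) (ModuleCat.of R C) i) :
      ofExt J (i + 1) m (ModuleCat.of R A)
        (((Abelian.Ext.mk₀ (powQuotMap J h)).comp x (zero_add i)).comp hS.extClass rfl) =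
      ofExt J (i + 1) n (ModuleCat.of R A) (x.comp hS.extClass rfl) := by
    rw [Abelian.Ext.comp_assoc _ _ _ (zero_add i) rfl (by omega), ofExt_precomp]
  let δ := descExt J (fun n ↦ ofExt J (i + 1) n (ModuleCat.of R A) ∘ₗ
    Abelian.Ext.postcompOfLinear hS.extClass R (powQuot J n) rfl) hcompat
  have hδ (n : ℕ) (x : Abelian.Ext (powQuot J n) (ModuleCat.of R C) i) :
      δ (ofExt J i n _ x) = ofExt J (i + 1) n _ (x.comp hS.extClass rfl) :=
    descExt_ofExt J _ hcompat n x
  refine ⟨δ, fun x ↦ ⟨fun hx ↦ ?_, ?_⟩, fun x ↦ ⟨fun hx ↦ ?_, ?_⟩⟩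
  · obtain ⟨n, y, rfl⟩ := exists_ofExt_eq J _ x
    rw [hδ, ofExt_eq_zero_iff] at hx
    obtain ⟨m, h, hm⟩ := hx
    rw [← Abelian.Ext.comp_assoc _ _ _ (zero_add i) rfl (by omega)] at hm
    obtain ⟨z, hz⟩ := Abelian.Ext.covariant_sequence_exact₃ _ hS _ rfl hm
    exact ⟨ofExt J i m _ z, by rw [mapₗ_ofExt]; exact (congrArg _ hz).trans (ofExt_precomp J h _ y)⟩
  · rintro ⟨y, rfl⟩
    obtain ⟨n, z, rfl⟩ := exists_ofExt_eq J _ y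
    rw [mapₗ_ofExt, hδ, Abelian.Ext.comp_assoc_of_second_deg_zero]
    erw [hS.comp_extClass]
    rw [Abelian.Ext.comp_zero, map_zero]
  · obtain ⟨n, y, rfl⟩ := exists_ofExt_eq J _ x
    rw [mapₗ_ofExt, ofExt_eq_zero_iff] at hx
    obtain ⟨m, h, hm⟩ := hx
    rw [← Abelian.Ext.comp_assoc_of_third_deg_zero] at hm
    obtain ⟨z, hz⟩ := Abelian.Ext.covariant_sequence_exact₁ _ hS _ hm rfl
    exact ⟨ofExt J i m _ z, by rw [hδ, hz]; exact ofExt_precomp J h _ y⟩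
  · rintro ⟨y, rfl⟩
    obtain ⟨n, z, rfl⟩ := exists_ofExt_eq J _ y
    rw [hδ, mapₗ_ofExt, Abelian.Ext.comp_assoc_of_third_deg_zero]
    erw [hS.extClass_comp]
    rw [Abelian.Ext.comp_zero, map_zero]

end LongExactSequence

/-! ### Degree zero: the power torsion submodule. -/

section DegreeZero

variable {M N : Type u} [AddCommGroup M] [Module R M] [AddCommGroup N] [Module R N]

lemma linearEquiv₀_mk₀ {X Y : ModuleCat.{u} R} (f : X ⟶ Y) :
    Abelian.Ext.linearEquiv₀ (R := R) (Abelian.Ext.mk₀ f) = f := by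
  rw [← Abelian.Ext.linearEquiv₀_symm_apply (R := R), LinearEquiv.apply_symm_apply]

/-- The inclusion of `H^0_J(M)` into `M`. -/
noncomputable def zeroToSelf (M : Type u) [AddCommGroup M] [Module R M] :
    (localCohomology J 0).obj (ModuleCat.of R M) →ₗ[R] M :=
  descExt J (fun n ↦
    { toFun x := (Abelian.Ext.linearEquiv₀ (R := R) x).hom (Submodule.Quotient.mk (1 : R))
      map_add' x y := by simp
      map_smul' r x := by simp }) (by
    intro n m h x
    obtain ⟨y, rfl⟩ := (Abelian.Ext.linearEquiv₀ (R := R)).symm.surjective x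
    simp only [Abelian.Ext.linearEquiv₀_symm_apply, Abelian.Ext.mk₀_comp_mk₀, LinearMap.coe_mk,
      AddHom.coe_mk, linearEquiv₀_mk₀]
    rfl)

lemma zeroToSelf_ofExt_mk₀ (n : ℕ) (f : R ⧸ J ^ n →ₗ[R] M) :
    zeroToSelf J M (ofExt J 0 n _ (Abelian.Ext.mk₀ (ModuleCat.ofHom f))) =
      f (Submodule.Quotient.mk 1) := by
  refine (descExt_ofExt J _ _ n _).trans ?_
  simp only [LinearMap.coe_mk, AddHom.coe_mk, linearEquiv₀_mk₀]
  rfl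

lemma exists_ofExt_mk₀_eq (x : (localCohomology J 0).obj (ModuleCat.of R M)) :
    ∃ n, ∃ f : R ⧸ J ^ n →ₗ[R] M, ofExt J 0 n _ (Abelian.Ext.mk₀ (ModuleCat.ofHom f)) = x := by
  obtain ⟨n, y, rfl⟩ := exists_ofExt_eq J _ x
  obtain ⟨f, rfl⟩ := (Abelian.Ext.linearEquiv₀ (R := R)).symm.surjective y
  exact ⟨n, f.hom, rfl⟩

lemma apply_zeroToSelf (φ : M →ₗ[R] N) (x : (localCohomology J 0).obj (ModuleCat.of R M)) :
    φ (zeroToSelf J M x) = zeroToSelf J N (mapₗ J 0 φ x) := by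
  obtain ⟨n, f, rfl⟩ := exists_ofExt_mk₀_eq J x
  rw [mapₗ_ofExt, Abelian.Ext.mk₀_comp_mk₀, ← ModuleCat.ofHom_comp, zeroToSelf_ofExt_mk₀,
    zeroToSelf_ofExt_mk₀]
  rfl

lemma zeroToSelf_injective : Function.Injective (zeroToSelf J M) := by
  rw [injective_iff_map_eq_zero]
  intro x hx
  obtain ⟨n, f, rfl⟩ := exists_ofExt_mk₀_eq J x
  rw [zeroToSelf_ofExt_mk₀] at hx
  have hf : f = 0 := by
    ext
    exact hx
  rw [hf, ModuleCat.ofHom_zero, Abelian.Ext.mk₀_zero, map_zero]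

lemma mem_range_zeroToSelf (x : M) :
    x ∈ LinearMap.range (zeroToSelf J M) ↔ ∃ n, ∀ r ∈ J ^ n, r • x = 0 := by
  constructor
  · rintro ⟨y, rfl⟩
    obtain ⟨n, f, rfl⟩ := exists_ofExt_mk₀_eq J y
    refine ⟨n, fun r hr ↦ ?_⟩
    rw [zeroToSelf_ofExt_mk₀, ← map_smul, ← Submodule.Quotient.mk_smul,
      (Submodule.Quotient.mk_eq_zero _).2 (by simpa using hr), map_zero]
  · rintro ⟨n, hn⟩
    refine ⟨ofExt J 0 n _ (Abelian.Ext.mk₀ (ModuleCat.ofHom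
      ((J ^ n).liftQ (LinearMap.toSpanSingleton R M x) fun r hr ↦ hn r hr))), ?_⟩
    rw [zeroToSelf_ofExt_mk₀]
    exact one_smul R x

end DegreeZero

end localCohomology

/-! ### Acyclicity of power torsion modules. -/

namespace localCohomology
variable {R : Type u} [CommRing R] (J : Ideal R)

/-- Every element of `M` is annihilated by a power of `J`. -/
def IsPowTorsion (M : Type*) [AddCommGroup M] [Module R M] : Prop :=
  ∀ x : M, ∃ n : ℕ, ∀ r ∈ J ^ n, r • x = 0

variable {J}

namespace IsPowTorsion

variable {M N : Type*} [AddCommGroup M] [Module R M] [AddCommGroup N] [Module R N]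

lemma of_injective (hN : IsPowTorsion J N) {f : M →ₗ[R] N} (hf : Function.Injective f) :
    IsPowTorsion J M := fun x ↦ by
  obtain ⟨n, hn⟩ := hN (f x)
  exact ⟨n, fun r hr ↦ hf (by rw [map_smul, hn r hr, map_zero])⟩

lemma of_surjective (hM : IsPowTorsion J M) {f : M →ₗ[R] N} (hf : Function.Surjective f) :
    IsPowTorsion J N := fun x ↦ by
  obtain ⟨x, rfl⟩ := hf x
  obtain ⟨n, hn⟩ := hM x
  exact ⟨n, fun r hr ↦ by rw [← map_smul, hn r hr, map_zero]⟩

lemma exists_pow_smul_eq_zero [Module.Finite R M] (hM : IsPowTorsion J M) :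
    ∃ n : ℕ, ∀ r ∈ J ^ n, ∀ x : M, r • x = 0 := by
  obtain ⟨s, hs⟩ := Module.Finite.fg_top (R := R) (M := M)
  choose k hk using hM
  refine ⟨s.sup k, fun r hr x ↦ ?_⟩
  have h : (⊤ : Submodule R M) ≤ LinearMap.ker (LinearMap.lsmul R M r) := by
    rw [← hs, Submodule.span_le]
    intro y hy
    exact hk y r (Ideal.pow_le_pow_right (Finset.le_sup hy) hr)
  exact h Submodule.mem_top

end IsPowTorsion

lemma isPowTorsion_range_zeroToSelf (M : Type u) [AddCommGroup M] [Module R M] :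
    IsPowTorsion J (LinearMap.range (zeroToSelf J M)) := fun x ↦ by
  obtain ⟨n, hn⟩ := (mem_range_zeroToSelf J x.1).1 x.2
  exact ⟨n, fun r hr ↦ Subtype.ext (hn r hr)⟩

/-- The `J`-power torsion of an injective module over a Noetherian ring is injective. -/
lemma baer_range_zeroToSelf [IsNoetherianRing R] {E : Type u} [AddCommGroup E] [Module R E]
    (hE : Module.Baer R E) : Module.Baer R (LinearMap.range (zeroToSelf J E)) := by
  intro a g
  obtain ⟨k, hk⟩ := ((isPowTorsion_range_zeroToSelf (J := J) E).of_injective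
    (LinearMap.range g).injective_subtype).exists_pow_smul_eq_zero
  -- Artin–Rees: `J ^ (c + k) ∩ a ⊆ J ^ k a`, which `g` kills. So `g` factors through the image of
  -- `a` in `R ⧸ J ^ (c + k)`, and an extension to that quotient automatically has torsion values.
  obtain ⟨c, hc⟩ := J.exists_pow_inf_eq_pow_smul a
  have hle : J ^ k • (a : Submodule R R) ≤ (LinearMap.ker g).map a.subtype := by
    rw [Submodule.smul_le]
    intro r hr y hy
    refine ⟨r • ⟨y, hy⟩, ?_, rfl⟩
    rw [SetLike.mem_coe, LinearMap.mem_ker, map_smul]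
    exact congrArg Subtype.val (hk r hr ⟨g ⟨y, hy⟩, _, rfl⟩)
  let p : a →ₗ[R] R ⧸ J ^ (c + k) := (J ^ (c + k)).mkQ ∘ₗ a.subtype
  have hp : LinearMap.ker p ≤ LinearMap.ker g := by
    intro x hx
    have hx' : (x : R) ∈ J ^ (c + k) := (Submodule.Quotient.mk_eq_zero _).1 hx
    have h1 : (x : R) ∈ J ^ (c + k) • (⊤ : Submodule R R) ⊓ a := ⟨by simpa using hx', x.2⟩
    rw [hc _ (Nat.le_add_right _ _), Nat.add_sub_cancel_left] at h1
    obtain ⟨y, hy, hyx⟩ := hle (Submodule.smul_mono le_rfl inf_le_right h1)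
    exact (Subtype.ext hyx : y = x) ▸ hy
  have hinj : Function.Injective ((LinearMap.ker p).liftQ p le_rfl) := by
    rw [← LinearMap.ker_eq_bot]
    exact Submodule.ker_liftQ_eq_bot _ _ _ le_rfl
  obtain ⟨h, hh⟩ := hE.extension_property _ hinj
    ((LinearMap.range (zeroToSelf J E)).subtype ∘ₗ (LinearMap.ker p).liftQ g hp)
  refine ⟨(h ∘ₗ (J ^ (c + k)).mkQ).codRestrict _ fun x ↦ ?_, fun x hx ↦ ?_⟩
  · rw [mem_range_zeroToSelf]
    refine ⟨c + k, fun r hr ↦ ?_⟩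
    rw [← map_smul, LinearMap.comp_apply,
      show (J ^ (c + k)).mkQ (r • x) = 0 from
        (Submodule.Quotient.mk_eq_zero _).2 (Ideal.mul_mem_right _ _ hr), map_zero]
  · exact Subtype.ext (LinearMap.congr_fun hh (Submodule.Quotient.mk ⟨x, hx⟩))

lemma zeroToSelf_bijective {M : Type u} [AddCommGroup M] [Module R M] (hM : IsPowTorsion J M) :
    Function.Bijective (zeroToSelf J M) :=
  ⟨zeroToSelf_injective J, fun x ↦ (mem_range_zeroToSelf J x).2 (hM x)⟩

/-- A `J`-power torsion module over a Noetherian ring embeds into an injective module which is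
`J`-power torsion. -/
lemma IsPowTorsion.exists_injective [IsNoetherianRing R] {T : Type u} [AddCommGroup T]
    [Module R T] (hT : IsPowTorsion J T) :
    ∃ (D : ModuleCat.{u} R) (j : T →ₗ[R] D), Injective (ModuleCat.of R D) ∧ IsPowTorsion J D ∧
      Function.Injective j := by
  obtain ⟨⟨E, _, f, _⟩⟩ := EnoughInjectives.presentation (ModuleCat.of R T)
  have hE : Module.Injective R E := Module.injective_module_of_injective_object R E
  have hΓ := (baer_range_zeroToSelf (J := J) (Module.Baer.of_injective hE)).injective
  refine ⟨ModuleCat.of R (LinearMap.range (zeroToSelf J E)), f.hom.codRestrict _ fun x ↦ ?_,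
    Module.injective_object_of_injective_module R _, isPowTorsion_range_zeroToSelf E,
    fun x y hxy ↦ (ModuleCat.mono_iff_injective f).1 inferInstance (congrArg Subtype.val hxy)⟩
  rw [mem_range_zeroToSelf]
  obtain ⟨n, hn⟩ := hT x
  exact ⟨n, fun r hr ↦ by rw [← map_smul, hn r hr, map_zero]⟩

/-- Higher local cohomology of a `J`-power torsion module over a Noetherian ring vanishes. -/
theorem IsPowTorsion.subsingleton [IsNoetherianRing R] (i : ℕ) {T : Type u} [AddCommGroup T]
    [Module R T] (hT : IsPowTorsion J T) :
    Subsingleton ((localCohomology J (i + 1)).obj (ModuleCat.of R T)) := by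
  induction i generalizing T with
  | zero =>
    obtain ⟨D, j, hD, hDt, hj⟩ := hT.exists_injective
    have hs := (LinearMap.range j).mkQ_surjective
    obtain ⟨δ, h1, h2⟩ := exists_connecting J 0 hj (LinearMap.exact_map_mkQ_range j) hs
    have := subsingleton_of_injective_module J 0 (M := D)
    refine subsingleton_of_forall_eq 0 fun x ↦ ?_
    obtain ⟨y, rfl⟩ := (h2 x).1 (Subsingleton.elim _ _)
    -- Since `D` is entirely torsion, any lift to `D` is a class in `H^0(D)`; hence the connecting
    -- map vanishes.
    obtain ⟨z, hz⟩ := hs (zeroToSelf J _ y)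
    obtain ⟨w, rfl⟩ := (zeroToSelf_bijective hDt).2 z
    rw [apply_zeroToSelf] at hz
    exact (h1 y).2 ⟨w, zeroToSelf_injective J hz⟩
  | succ i ih =>
    obtain ⟨D, j, hD, hDt, hj⟩ := hT.exists_injective
    have hs := (LinearMap.range j).mkQ_surjective
    obtain ⟨δ, h1, h2⟩ := exists_connecting J (i + 1) hj (LinearMap.exact_map_mkQ_range j) hs
    have := subsingleton_of_injective_module J (i + 1) (M := D)
    have := ih (hDt.of_surjective hs)
    refine subsingleton_of_forall_eq 0 fun x ↦ ?_
    obtain ⟨y, rfl⟩ := (h2 x).1 (Subsingleton.elim _ _)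
    rw [Subsingleton.elim y 0, map_zero]

end localCohomology

open IsLocalRing

open scoped Pointwise

/-! ### Finite length and annihilation by powers of the maximal ideal. -/

section FiniteLength

variable {R : Type*} [CommRing R]

lemma IsFiniteLength.of_exact {A B C : Type*} [AddCommGroup A] [Module R A] [AddCommGroup B]
    [Module R B] [AddCommGroup C] [Module R C] {f : A →ₗ[R] B} {g : B →ₗ[R] C}
    (h : Function.Exact f g) (hA : IsFiniteLength R A) (hC : IsFiniteLength R C) :
    IsFiniteLength R B := by
  rw [isFiniteLength_iff_isNoetherian_isArtinian] at *
  obtain ⟨_, _⟩ := hA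
  obtain ⟨_, _⟩ := hC
  exact ⟨isNoetherian_of_range_eq_ker f g h.linearMap_ker_eq.symm,
    isArtinian_of_range_eq_ker f g h.linearMap_ker_eq.symm⟩

/-- A module of length at most `n` over a local ring is annihilated by the `n`-th power of the
maximal ideal. -/
lemma IsLocalRing.pow_maximalIdeal_smul_eq_zero [IsLocalRing R] (n : ℕ) {M : Type*}
    [AddCommGroup M] [Module R M] (h : Module.length R M ≤ n) {r : R}
    (hr : r ∈ maximalIdeal R ^ n) (x : M) : r • x = 0 := by
  suffices hs : maximalIdeal R ^ n • (⊤ : Submodule R M) = ⊥ by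
    have := Submodule.smul_mem_smul hr (Submodule.mem_top (x := x))
    rwa [hs, Submodule.mem_bot] at this
  clear hr x r
  induction n generalizing M with
  | zero =>
    have : Subsingleton M := Module.length_eq_zero_iff.1 (le_antisymm (by simpa using h) bot_le)
    exact Subsingleton.elim _ _
  | succ n ih =>
    have hfin : Module.length R M ≠ ⊤ := (h.trans_lt (ENat.natCast_lt_top _)).ne
    rw [Module.length_ne_top_iff, isFiniteLength_iff_isNoetherian_isArtinian] at hfin
    obtain ⟨_, _⟩ := hfin
    rcases subsingleton_or_nontrivial M with _ | _
    · exact Subsingleton.elim _ _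
    -- Nakayama: multiplying by `𝔪` strictly lowers the length.
    have hne : maximalIdeal R • (⊤ : Submodule R M) ≠ ⊤ := fun he ↦
      top_ne_bot (Submodule.eq_bot_of_le_smul_of_le_jacobson_bot (maximalIdeal R) ⊤
        (IsNoetherian.noetherian _) he.ge (maximalIdeal_le_jacobson _))
    have hlt : Module.length R ↥(maximalIdeal R • (⊤ : Submodule R M)) < (n : ℕ∞) + 1 :=
      (Submodule.length_lt hne).trans_le (by exact_mod_cast h)
    have h1 := congrArg (Submodule.map (maximalIdeal R • (⊤ : Submodule R M)).subtype)
      (ih (Order.le_of_lt_add_one hlt))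
    rwa [Submodule.map_smul'', Submodule.map_subtype_top, Submodule.map_bot, ← Submodule.mul_smul,
      ← pow_succ] at h1

end FiniteLength

/-! ### Submodules of small dimension are torsion. -/

section SupportDim
variable {R : Type*} [CommRing R] [IsLocalRing R] [IsNoetherianRing R]

lemma isPowTorsion_of_supportDim_le_zero {N : Type*} [AddCommGroup N] [Module R N]
    [Module.Finite R N] (h : Module.supportDim R N ≤ 0) :
    localCohomology.IsPowTorsion (maximalIdeal R) N := by
  rcases subsingleton_or_nontrivial N with _ | _
  · exact fun x ↦ ⟨0, fun r _ ↦ Subsingleton.elim _ _⟩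
  have h0 : Module.supportDim R N = 0 :=
    le_antisymm h (by
      have := Module.supportDim_ne_bot_of_nontrivial R N
      obtain ⟨a, ha⟩ := WithBot.ne_bot_iff_exists.1 this
      rw [← ha]
      exact_mod_cast bot_le (a := a))
  have hs := support_of_supportDim_eq_zero R N h0
  have hle : maximalIdeal R ≤ (Module.annihilator R N).radical := by
    rw [Ideal.radical_eq_sInf, le_sInf_iff]
    rintro p ⟨hp, hp'⟩
    have : (⟨p, hp'⟩ : PrimeSpectrum R) ∈ Module.support R N := by
      rw [Module.support_eq_zeroLocus]
      exact hp
    rw [hs] at this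
    exact this
  obtain ⟨k, hk⟩ := Ideal.exists_pow_le_of_le_radical_of_fg hle (IsNoetherian.noetherian _)
  exact fun x ↦ ⟨k, fun r hr ↦ Module.mem_annihilator.1 (hk hr) x⟩

end SupportDim

namespace localCohomology

variable {R : Type u} [CommRing R] [IsLocalRing R] [IsNoetherianRing R]

/-- The hypothesis says `Hom(R/𝔪, M) = 0`, which is equivalent to the existence of an `M`-regular
element in `Ann(R/𝔪) = 𝔪`. -/
lemma exists_isSMulRegular {M : Type*} [AddCommGroup M] [Module R M] [Module.Finite R M]
    (hM : ∀ x : M, (∀ r ∈ maximalIdeal R, r • x = 0) → x = 0) :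
    ∃ y ∈ maximalIdeal R, IsSMulRegular M y := by
  have : Subsingleton (R ⧸ maximalIdeal R →ₗ[R] M) := by
    refine subsingleton_of_forall_eq 0 fun f ↦ ?_
    ext
    refine hM _ fun r hr ↦ ?_
    have h0 : r • (1 : R ⧸ maximalIdeal R) = 0 := by
      rw [Algebra.smul_def, mul_one]
      exact Ideal.Quotient.eq_zero_iff_mem.2 hr
    exact (map_smul f r 1).symm.trans (by rw [h0, map_zero])
  obtain ⟨r, hr, h⟩ := IsSMulRegular.subsingleton_linearMap_iff.1 this
  exact ⟨r, by simpa [Ideal.annihilator_quotient] using hr, h⟩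

omit [IsLocalRing R] in
/-- The quotient by the torsion submodule is torsion-free. -/
lemma eq_zero_of_pow_smul_eq_zero (J : Ideal R) {M : Type u} [AddCommGroup M] [Module R M]
    [Module.Finite R M] (n : ℕ) (x : M ⧸ LinearMap.range (zeroToSelf J M))
    (hx : ∀ r ∈ J ^ n, r • x = 0) : x = 0 := by
  obtain ⟨z, rfl⟩ := Submodule.mkQ_surjective _ x
  obtain ⟨k, hk⟩ := (isPowTorsion_range_zeroToSelf (J := J) M).exists_pow_smul_eq_zero
  refine (Submodule.Quotient.mk_eq_zero _).2 ((mem_range_zeroToSelf J z).2 ⟨k + n, fun r hr ↦ ?_⟩)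
  rw [pow_add] at hr
  induction hr using Submodule.mul_induction_on' with
  | mem_mul_mem a ha b hb =>
    have hb' : b • z ∈ LinearMap.range (zeroToSelf J M) :=
      (Submodule.Quotient.mk_eq_zero _).1 (hx b hb)
    rw [mul_smul]
    exact congrArg Subtype.val (hk a ha ⟨b • z, hb'⟩)
  | add a ha b hb h1 h2 => rw [add_smul, h1, h2, add_zero]

omit [IsNoetherianRing R] in
lemma isFiniteLength_quotient_range_smul (t : ℕ) {M : Type u} [AddCommGroup M] [Module R M]
    (hM : ∀ i ≤ t + 1, IsFiniteLength R (localCohomologyAtMax R i M)) {b : R}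
    (hb : IsSMulRegular M b) (i : ℕ) (hi : i ≤ t) :
    IsFiniteLength R (localCohomologyAtMax R i (M ⧸ LinearMap.range (LinearMap.lsmul R M b))) := by
  have hex := LinearMap.exact_map_mkQ_range (LinearMap.lsmul R M b)
  have hs := (LinearMap.range (LinearMap.lsmul R M b)).mkQ_surjective
  obtain ⟨δ, h1, h2⟩ := exists_connecting (maximalIdeal R) i (f := LinearMap.lsmul R M b) hb hex hs
  exact .of_exact h1 (hM i (by omega)) (hM (i + 1) (by omega))

/-- If `a` is regular on the torsion-free module `M` and kills `H^1(M)`, then the submodule of `M`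
killed by an ideal vanishes as soon as its image in `M ⧸ a ^ 2 M` is torsion. -/
lemma torsionBySet_eq_bot {M : Type u} [AddCommGroup M] [Module R M] [Module.Finite R M]
    (htf : ∀ (n : ℕ) (x : M), (∀ r ∈ maximalIdeal R ^ n, r • x = 0) → x = 0) {a : R}
    (ha : a ∈ maximalIdeal R) (hreg : IsSMulRegular M a)
    (hkill : ∀ x : localCohomologyAtMax R 1 M, a • x = 0) (s : Set R)
    (htors : IsPowTorsion (maximalIdeal R) ((Submodule.torsionBySet R M s).map
      (LinearMap.range (LinearMap.lsmul R M (a * a))).mkQ)) :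
    Submodule.torsionBySet R M s = ⊥ := by
  have hb : Function.Injective (LinearMap.lsmul R M (a * a)) := hreg.mul hreg
  have hex := LinearMap.exact_map_mkQ_range (LinearMap.lsmul R M (a * a))
  have hs := (LinearMap.range (LinearMap.lsmul R M (a * a))).mkQ_surjective
  obtain ⟨δ, h1, -⟩ := exists_connecting (maximalIdeal R) 0 hb hex hs
  refine Submodule.eq_bot_of_le_smul_of_le_jacobson_bot (maximalIdeal R) _
    (IsNoetherian.noetherian _) (fun z hz ↦ ?_) (maximalIdeal_le_jacobson _)
  obtain ⟨n, hn⟩ := htors ⟨_, z, hz, rfl⟩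
  obtain ⟨w, hw⟩ := (mem_range_zeroToSelf (maximalIdeal R)
    ((LinearMap.range (LinearMap.lsmul R M (a * a))).mkQ z)).2
      ⟨n, fun r hr ↦ congrArg Subtype.val (hn r hr)⟩
  -- The torsion class `w` lifting the image of `z` becomes, after multiplication by `a`, a class
  -- from `H^0(M) = 0`. Thus `a z ∈ a ^ 2 M`, so `z ∈ a M`; the square is what leaves a factor `a`
  -- after cancelling.
  have hδ : δ (a • w) = 0 := by rw [map_smul]; exact hkill _
  obtain ⟨v, hv⟩ := (h1 _).1 hδ
  have hv0 : v = 0 := by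
    apply zeroToSelf_injective
    obtain ⟨k, hk⟩ := (mem_range_zeroToSelf (maximalIdeal R) _).1 ⟨v, rfl⟩
    rw [map_zero, htf k _ hk]
  have haz : (LinearMap.range (LinearMap.lsmul R M (a * a))).mkQ (a • z) = 0 := by
    rw [map_smul, ← hw, ← map_smul, ← hv, hv0, map_zero, map_zero]
  obtain ⟨x, hx⟩ := (Submodule.Quotient.mk_eq_zero _).1 haz
  have hzx : z = a • x := hreg (by
    change a • z = a • (a • x)
    rw [← mul_smul]
    exact hx.symm)
  rw [hzx]
  -- Regularity of `a` keeps `x` in the same torsion submodule, so that submodule lies in `𝔪` times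
  -- itself.
  refine Submodule.smul_mem_smul ha ((Submodule.mem_torsionBySet_iff _ _).2 fun r ↦ hreg ?_)
  have hz' := (Submodule.mem_torsionBySet_iff _ _).1 hz r
  rw [hzx, smul_comm] at hz'
  change a • (r : R) • x = a • (0 : M)
  rw [hz', smul_zero]

omit [IsLocalRing R] in
lemma supportDim_torsionBySet_annihilator_le {M N : Type*} [AddCommGroup M] [Module R M]
    [Module.Finite R M] [AddCommGroup N] [Module R N] [Module.Finite R N] :
    Module.supportDim R (Submodule.torsionBySet R M (Module.annihilator R N)) ≤
      Module.supportDim R N := by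
  rw [Module.supportDim_eq_ringKrullDim_quotient_annihilator,
    Module.supportDim_eq_ringKrullDim_quotient_annihilator]
  have hle : Module.annihilator R N ≤
      Module.annihilator R (Submodule.torsionBySet R M (Module.annihilator R N)) := fun r hr ↦
    Module.mem_annihilator.2 fun x ↦
      Subtype.ext ((Submodule.mem_torsionBySet_iff _ _).1 x.2 ⟨r, hr⟩)
  exact ringKrullDim_le_of_surjective _ (Ideal.Quotient.factor_surjective hle)

/-- The image of `N` in `M ⧸ bM` is a quotient of `N ⧸ bN`, and `b` is regular on `N`. -/
lemma supportDim_map_mkQ_le {M : Type*} [AddCommGroup M] [Module R M]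
    [Module.Finite R M] (N : Submodule R M) {b : R} (hb : b ∈ maximalIdeal R)
    (hreg : IsSMulRegular M b) (t : ℕ) (hN : Module.supportDim R N ≤ (t + 1 : ℕ)) :
    Module.supportDim R (N.map (LinearMap.range (LinearMap.lsmul R M b)).mkQ) ≤ t := by
  have hregN : IsSMulRegular N b := fun x y hxy ↦ Subtype.ext (hreg (congrArg Subtype.val hxy))
  have h := Module.supportDim_quotSMulTop_succ_eq_supportDim hregN hb
  rw [← h] at hN
  have hle : Module.supportDim R (QuotSMulTop b N) ≤ t := by
    have : Module.supportDim R (QuotSMulTop b N) + 1 ≤ (t : WithBot ℕ∞) + 1 := by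
      exact_mod_cast hN
    generalize Module.supportDim R (QuotSMulTop b N) = D at this ⊢
    induction D with
    | bot => exact bot_le
    | coe a =>
      have h1 : a + 1 ≤ (t : ℕ∞) + 1 := by exact_mod_cast this
      exact_mod_cast (ENat.add_le_add_iff_right ENat.one_ne_top).1 h1
  refine le_trans ?_ hle
  let g : N →ₗ[R] N.map (LinearMap.range (LinearMap.lsmul R M b)).mkQ :=
    (LinearMap.range (LinearMap.lsmul R M b)).mkQ.submoduleMap N
  have hg : (b • ⊤ : Submodule R N) ≤ LinearMap.ker g := by
    intro x hx
    obtain ⟨y, -, rfl⟩ := (Submodule.mem_smul_pointwise_iff_exists _ _ _).1 hx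
    exact Subtype.ext ((Submodule.Quotient.mk_eq_zero _).2 ⟨y, rfl⟩)
  refine Module.supportDim_le_of_surjective ((b • ⊤ : Submodule R N).liftQ g hg) ?_
  rintro ⟨_, x, hx, rfl⟩
  exact ⟨Submodule.Quotient.mk ⟨x, hx⟩, rfl⟩

/-- A submodule of dimension at most `t` of a module `M` such that the local cohomology of `M` has
finite length in degrees at most `t` is torsion. -/
theorem isPowTorsion_of_supportDim_le (t : ℕ) {M N : Type u} [AddCommGroup M] [Module R M]
    [Module.Finite R M] [AddCommGroup N] [Module R N] [Module.Finite R N]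
    (hM : ∀ i ≤ t, IsFiniteLength R (localCohomologyAtMax R i M)) {φ : N →ₗ[R] M}
    (hφ : Function.Injective φ) (hN : Module.supportDim R N ≤ t) :
    IsPowTorsion (maximalIdeal R) N := by
  induction t generalizing M N with
  | zero => exact isPowTorsion_of_supportDim_le_zero (by simpa using hN)
  | succ t ih =>
    have htf := eq_zero_of_pow_smul_eq_zero (maximalIdeal R) (M := M)
    have hM' (i : ℕ) (hi : i ≤ t + 1) : IsFiniteLength R
        (localCohomologyAtMax R i (M ⧸ LinearMap.range (zeroToSelf (maximalIdeal R) M))) := by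
      obtain ⟨δ, h1, -⟩ := exists_connecting (maximalIdeal R) i
        (LinearMap.range (zeroToSelf (maximalIdeal R) M)).injective_subtype
        (LinearMap.exact_subtype_mkQ _)
        (LinearMap.range (zeroToSelf (maximalIdeal R) M)).mkQ_surjective
      -- `H^{i+1}` of the torsion part vanishes, so `H^i(M)` surjects onto `H^i` of the quotient.
      have := (isPowTorsion_range_zeroToSelf (J := maximalIdeal R) M).subsingleton i
      exact (hM i hi).of_surjective fun x ↦ (h1 x).1 (Subsingleton.elim _ _)
    set M' := M ⧸ LinearMap.range (zeroToSelf (maximalIdeal R) M)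
    obtain ⟨y, hy, hyreg⟩ := exists_isSMulRegular (R := R) (M := M')
      fun x hx ↦ htf 1 x (by simpa using hx)
    obtain ⟨l, hl⟩ := ENat.ne_top_iff_exists.1 (Module.length_ne_top_iff.2 (hM' 1 (by omega)))
    -- The exponent `l` would kill `H^1`; the extra 1 keeps the power in `𝔪` when `l = 0`.
    have ha : y ^ (l + 1) ∈ maximalIdeal R := Ideal.pow_mem_of_mem _ hy _ (Nat.succ_pos l)
    have hareg : IsSMulRegular M' (y ^ (l + 1)) := hyreg.pow _
    have hkill (x : localCohomologyAtMax R 1 M') : y ^ (l + 1) • x = 0 :=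
      pow_maximalIdeal_smul_eq_zero l hl.ge
        (Ideal.pow_le_pow_right (Nat.le_succ l) (Ideal.pow_mem_pow hy _)) x
    -- The image of `N` is enlarged to everything killed by `Ann N`: this costs no dimension and,
    -- unlike the image, is stable under division by a regular element.
    have hbot := torsionBySet_eq_bot htf ha hareg hkill (Module.annihilator R N)
      (ih (isFiniteLength_quotient_range_smul t hM' (hareg.mul hareg))
        (Submodule.injective_subtype _)
        (supportDim_map_mkQ_le _ (Ideal.mul_mem_left _ _ ha) (hareg.mul hareg) t
          (supportDim_torsionBySet_annihilator_le.trans hN)))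
    refine (isPowTorsion_range_zeroToSelf (J := maximalIdeal R) M).of_injective
      (f := φ.codRestrict _ fun x ↦ ?_) fun x y hxy ↦ hφ (congrArg Subtype.val hxy)
    have hx : (LinearMap.range (zeroToSelf (maximalIdeal R) M)).mkQ (φ x) ∈
        Submodule.torsionBySet R M' (Module.annihilator R N) :=
      (Submodule.mem_torsionBySet_iff _ _).2 fun r ↦ by
        rw [← map_smul, ← map_smul, Module.mem_annihilator.1 r.2, map_zero, map_zero]
    rw [hbot] at hx
    exact (Submodule.Quotient.mk_eq_zero _).1 hx

end localCohomology

/-! ### The length formula. -/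

namespace localCohomology

/-- Suppose multiplication by `f` on `M` factors as a surjection `p : M → A` with `J`-power torsion
kernel followed by an injection `j : A → M` with cokernel `C`. Then the length of `H^i_J(C)` only
depends on the action of `f` on the local cohomology of `M`. -/
theorem length_eq_add {R : Type u} [CommRing R] [IsNoetherianRing R] (J : Ideal R) (f : R)
    {M A C : Type u} [AddCommGroup M] [Module R M] [AddCommGroup A] [Module R A] [AddCommGroup C]
    [Module R C] {p : M →ₗ[R] A} {j : A →ₗ[R] M} {q : M →ₗ[R] C} (hp : Function.Surjective p)
    (hK : IsPowTorsion J (LinearMap.ker p)) (hj : Function.Injective j)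
    (hpj : j ∘ₗ p = f • LinearMap.id) (hjq : Function.Exact j q) (hq : Function.Surjective q)
    (i : ℕ) :
    Module.length R ((localCohomology J i).obj (ModuleCat.of R C)) =
      Module.length R ((localCohomology J i).obj (ModuleCat.of R M) ⧸ LinearMap.range
        (f • LinearMap.id : (localCohomology J i).obj (ModuleCat.of R M) →ₗ[R] _)) +
      Module.length R (LinearMap.ker (f • LinearMap.id :
        (localCohomology J (i + 1)).obj (ModuleCat.of R M) →ₗ[R] _)) := by
  have hsurj (n : ℕ) : Function.Surjective (mapₗ J n p) := by
    obtain ⟨δ, h1, -⟩ := exists_connecting J n (LinearMap.ker p).injective_subtype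
      (LinearMap.exact_subtype_ker_map p) hp
    have := hK.subsingleton n
    exact fun x ↦ (h1 x).1 (Subsingleton.elim _ _)
  -- Injectivity may fail in degree 0, but only degree `i + 1` is needed.
  have hinj : Function.Injective (mapₗ J (i + 1) p) := by
    have h := exact_mapₗ J (i + 1) (LinearMap.ker p).injective_subtype
      (LinearMap.exact_subtype_ker_map p) hp
    have := hK.subsingleton i
    rw [injective_iff_map_eq_zero]
    intro x hx
    obtain ⟨y, rfl⟩ := (h x).1 hx
    rw [Subsingleton.elim y 0, map_zero]
  have hcomp (n : ℕ) : mapₗ J n j ∘ₗ mapₗ J n p = f • LinearMap.id := by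
    rw [← mapₗ_comp, hpj, mapₗ_smul_id]
  obtain ⟨δ, h1, h2⟩ := exists_connecting J i hj hjq hq
  have h0 := exact_mapₗ J i hj hjq hq
  rw [Module.length_eq_add_of_exact (LinearMap.ker δ).subtype δ.rangeRestrict
    (LinearMap.ker δ).injective_subtype δ.surjective_rangeRestrict
    (by rw [LinearMap.exact_iff, LinearMap.ker_rangeRestrict, Submodule.range_subtype])]
  congr 1
  · rw [h1.linearMap_ker_eq, ← hcomp i, LinearMap.range_comp, LinearMap.range_eq_top.2 (hsurj i),
      Submodule.map_top, ← h0.linearMap_ker_eq]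
    exact (mapₗ J i q).quotKerEquivRange.length_eq.symm
  · rw [← h2.linearMap_ker_eq, ← hcomp (i + 1), LinearMap.ker_comp]
    exact (LinearEquiv.length_eq
      ((LinearEquiv.ofBijective _ ⟨hinj, hsurj (i + 1)⟩).submoduleMap _ ≪≫ₗ
        LinearEquiv.ofEq _ _ (Submodule.map_comap_eq_of_surjective (hsurj (i + 1)) _))).symm

variable {R : Type u} [CommRing R] [IsLocalRing R] [IsNoetherianRing R]

/-- If the annihilator of `f` is torsion, the length of the local cohomology of `R ⧸ (f)` only
depends on the action of `f` on the local cohomology of `R`. -/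
theorem length_quotient_span_singleton (f : R)
    (hK : IsPowTorsion (maximalIdeal R) (LinearMap.ker (LinearMap.lsmul R R f))) (i : ℕ) :
    Module.length R (localCohomologyAtMax R i (R ⧸ Ideal.span {f})) =
      Module.length R (localCohomologyAtMax R i R ⧸ LinearMap.range
        (f • LinearMap.id : localCohomologyAtMax R i R →ₗ[R] _)) +
      Module.length R (LinearMap.ker (f • LinearMap.id :
        localCohomologyAtMax R (i + 1) R →ₗ[R] _)) := by
  have hmem (x : R) : (LinearMap.lsmul R R f) x ∈ Ideal.span {f} :=
    Ideal.mem_span_singleton.2 (Dvd.intro _ rfl)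
  refine length_eq_add (maximalIdeal R) f (M := R) (A := Ideal.span {f})
    (p := (LinearMap.lsmul R R f).codRestrict _ hmem) (j := (Ideal.span {f}).subtype)
    (q := (Ideal.span {f}).mkQ) ?_ ?_ (Submodule.injective_subtype _) rfl
    (LinearMap.exact_subtype_mkQ _) (Submodule.mkQ_surjective _) i
  · rintro ⟨x, hx⟩
    obtain ⟨y, rfl⟩ := Ideal.mem_span_singleton.1 hx
    exact ⟨y, rfl⟩
  · rwa [LinearMap.ker_codRestrict]

end localCohomology

/-! ### Parameter elements and the Buchsbaum invariant. -/

section Parameter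

variable {R : Type u} [CommRing R] [IsLocalRing R] [IsNoetherianRing R]

/-- The other `n` elements generate an ideal of the quotient whose only prime is maximal; Krull's
height theorem bounds its height. -/
lemma ringKrullDim_quotient_span_le {n : ℕ} {x : Fin (n + 1) → R}
    (hx : (Ideal.span (Set.range x)).radical = maximalIdeal R) :
    ringKrullDim (R ⧸ Ideal.span {x 0}) ≤ n := by
  have hmem : Ideal.span {x 0} ≤ maximalIdeal R := by
    rw [← hx, Ideal.span_singleton_le_iff_mem]
    exact Ideal.le_radical (Ideal.subset_span ⟨0, rfl⟩)
  have : Nontrivial (R ⧸ Ideal.span {x 0}) := Ideal.Quotient.nontrivial_iff.2 fun h ↦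
    (maximalIdeal.isMaximal R).ne_top (top_le_iff.1 (h ▸ hmem))
  have : IsLocalRing (R ⧸ Ideal.span {x 0}) := .of_surjective' _ Ideal.Quotient.mk_surjective
  let s : Set (R ⧸ Ideal.span {x 0}) :=
    Set.range fun i : Fin n ↦ Ideal.Quotient.mk (Ideal.span {x 0}) (x i.succ)
  have hprime (q : Ideal (R ⧸ Ideal.span {x 0})) [q.IsPrime] (hq : Ideal.span s ≤ q) :
      q = maximalIdeal _ := by
    have h1 : maximalIdeal R ≤ q.comap (Ideal.Quotient.mk _) := by
      rw [← hx, Ideal.IsPrime.radical_le_iff inferInstance, Ideal.span_le]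
      rintro _ ⟨i, rfl⟩
      refine Fin.cases ?_ (fun i ↦ hq (Ideal.subset_span ⟨i, rfl⟩)) i
      have h0 : Ideal.Quotient.mk (Ideal.span {x 0}) (x 0) = 0 :=
        Ideal.Quotient.eq_zero_iff_mem.2 (Ideal.mem_span_singleton_self _)
      change Ideal.Quotient.mk (Ideal.span {x 0}) (x 0) ∈ q
      rw [h0]
      exact q.zero_mem
    refine le_antisymm (le_maximalIdeal Ideal.IsPrime.ne_top') fun y hy ↦ ?_
    obtain ⟨y, rfl⟩ := Ideal.Quotient.mk_surjective y
    exact h1 fun hu ↦ hy (hu.map (Ideal.Quotient.mk _))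
  have hle : Ideal.span s ≤ maximalIdeal _ := by
    rw [Ideal.span_le]
    rintro _ ⟨i, rfl⟩ hu
    have h1 : x i.succ ∈ maximalIdeal R := by
      rw [← hx]
      exact Ideal.le_radical (Ideal.subset_span ⟨_, rfl⟩)
    have : IsLocalHom (Ideal.Quotient.mk (Ideal.span {x 0})) :=
      .of_surjective _ Ideal.Quotient.mk_surjective
    exact h1 (isUnit_of_map_unit _ _ hu)
  have hmin : maximalIdeal (R ⧸ Ideal.span {x 0}) ∈ (Ideal.span s).minimalPrimes :=
    ⟨⟨inferInstance, hle⟩, fun q ⟨_, hq⟩ _ ↦ (hprime q hq).ge⟩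
  rw [← maximalIdeal_height_eq_ringKrullDim]
  have h := Ideal.height_le_card_of_mem_minimalPrimes_span (Set.finite_range _) hmin
  have hcard : s.ncard ≤ n := by
    simpa [s, Set.image_univ] using Set.ncard_image_le (f := fun i : Fin n ↦
      Ideal.Quotient.mk (Ideal.span {x 0}) (x i.succ)) (s := Set.univ) Set.finite_univ
  exact_mod_cast h.trans (by exact_mod_cast hcard)

/-- `Ann f` is a module over `R/(f)`, so its dimension is at most `n = d - 1`, the last degree where
finite length is assumed. -/
lemma IsParameterElement.isPowTorsion (hR : IsGeneralizedCohenMacaulay R) {f : R}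
    (hf : IsParameterElement R f) :
    localCohomology.IsPowTorsion (maximalIdeal R) (LinearMap.ker (LinearMap.lsmul R R f)) := by
  obtain ⟨n, x, ⟨hn, hx⟩, rfl⟩ := hf
  refine localCohomology.isPowTorsion_of_supportDim_le n (M := R) (fun i hi ↦ hR i ?_)
    (Submodule.injective_subtype _) ?_
  · rw [hn]
    exact_mod_cast Nat.lt_succ_of_le hi
  · rw [Module.supportDim_eq_ringKrullDim_quotient_annihilator]
    have hle : Ideal.span {x 0} ≤
        Module.annihilator R (LinearMap.ker (LinearMap.lsmul R R (x 0))) := by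
      rw [Ideal.span_singleton_le_iff_mem, Module.mem_annihilator]
      exact fun y ↦ Subtype.ext y.2
    exact (ringKrullDim_le_of_surjective _ (Ideal.Quotient.factor_surjective hle)).trans
      (ringKrullDim_quotient_span_le hx)

lemma length_le_buchsbaumInvariant (R : Type u) [CommRing R] [IsLocalRing R] {d i : ℕ}
    (hi : i < d) :
    Module.length R (localCohomologyAtMax R i R) ≤ buchsbaumInvariant R d := by
  refine le_trans ?_ (Finset.single_le_sum (f := fun i ↦ ((d - 1).choose i : ℕ∞) *
    Module.length R (localCohomologyAtMax R i R)) (fun _ _ ↦ bot_le) (Finset.mem_range.2 hi))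
  have : (1 : ℕ∞) ≤ ((d - 1).choose i : ℕ∞) := by
    exact_mod_cast Nat.choose_pos (Nat.le_sub_one_of_lt hi)
  exact le_mul_of_one_le_left bot_le this

end Parameter

end

theorem mainTheorem3 (R : Type u) [CommRing R] [IsLocalRing R] [IsNoetherianRing R]
    (d : ℕ) (hd : ringKrullDim R = d) (hR : IsGeneralizedCohenMacaulay R)
    (f : R) (hf : IsParameterElement R f)
    (ε : R) (hε : ε ∈ IsLocalRing.maximalIdeal R ^ (buchsbaumInvariant R d).toNat)
    (hfε : IsParameterElement R (f + ε)) :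
    ∀ i : ℕ, i + 1 < d →
      Module.length R (localCohomologyAtMax R i (R ⧸ Ideal.span {f})) =
        Module.length R (localCohomologyAtMax R i (R ⧸ Ideal.span {f + ε})) := by
  intro i hi
  have hkill (k : ℕ) (hk : k < d) :
      ((f + ε) • LinearMap.id : localCohomologyAtMax R k R →ₗ[R] _) = f • LinearMap.id := by
    ext x
    have hle : Module.length R (localCohomologyAtMax R k R) ≤ (buchsbaumInvariant R d).toNat := by
      -- Finiteness of the invariant ensures that `toNat` is its true value and not the default 0.
      rw [ENat.natCast_toNat (buchsbaumInvariant_ne_top R d hd hR)]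
      exact length_le_buchsbaumInvariant R hk
    rw [add_smul, LinearMap.add_apply, LinearMap.smul_apply ε, LinearMap.id_apply,
      IsLocalRing.pow_maximalIdeal_smul_eq_zero _ hle hε, add_zero]
  rw [localCohomology.length_quotient_span_singleton f (hf.isPowTorsion hR),
    localCohomology.length_quotient_span_singleton (f + ε) (hfε.isPowTorsion hR),
    hkill i (by omega), hkill (i + 1) hi]
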